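/- Notation. A polytope $P\subset\mathbb{R}^n$ is the convex hull of finitely many points; it is a lattice polytope if all its vertices lie in $\mathbb{Z}^n$. The lattice length of a segment $[x,y]$ is the ratio of its Euclidean length to that of the primitive integer vector (the one with coprime components) in the direction of $y-x$. A lattice polytope $P$ is integrally closed if for every integer $c\ge 1$ every $z\in cP\cap\mathbb{Z}^n$ can be written as $z=x_1+\cdots+x_c$ with $x_1,\dots,x_c\in P\cap\mathbb{Z}^n$. It is normal if the same holds with respect to the lattice affinely generated by the lattice points of $P$: if $L$ is the group generated by all $x-y$ with $x,y\in P\cap\mathbb{Z}^n$, then for every $p\in P\cap\mathbb{Z}^n$ and every integer $c\ge 1$, every $z\in cP\cap(cp+L)$ can be written as $z=x_1+\cdots+x_c$ with $x_1,\dots,x_c\in P\cap(p+L)$. A parallelepiped is a (translate of a) Minkowski sum of segments of linearly independent directions; it is a lattice parallelepiped if its vertices lie in $\mathbb{Z}^n$. Theorem. Let $P\subset\mathbb{R}^n$ be a nonempty (not necessarily simple) lattice polytope of dimension $d$. (a) If the lattice length of every edge of $P$ is at least $2d^2(d+1)$, then $P$ is integrally closed, hence normal. (b) If $P$ is a simplex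 and the lattice length of every edge of $P$ is at least $d(d+1)$, then $P$ is covered by lattice parallelepipeds, i.e. $P$ is the union of the lattice parallelepipeds contained in $P$. In particular, $P$ is integrally closed. -/

import Mathlib

open scoped Pointwise

namespace LatticePolytope

/-- The integer lattice `ℤⁿ` inside Euclidean space `ℝⁿ`. -/
def intLattice (n : ℕ) : AddSubgroup (EuclideanSpace ℝ (Fin n)) where
  carrier := {x | ∀ i, ∃ m : ℤ, x i = (m : ℝ)}
  zero_mem' := fun _ => ⟨0, by simp⟩
  add_mem' := by
    intro x y hx hy i
    obtain ⟨a, ha⟩ := hx i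
    obtain ⟨b, hb⟩ := hy i
    exact ⟨a + b, by simp [ha, hb]⟩
  neg_mem' := by
    intro x hx i
    obtain ⟨a, ha⟩ := hx i
    exact ⟨-a, by simp [ha]⟩

/-- The real vector with the integer coordinates `u`. -/
def ofInt {n : ℕ} (u : Fin n → ℤ) : EuclideanSpace ℝ (Fin n) :=
  WithLp.toLp 2 (fun i => (u i : ℝ))

/-- A (convex) polytope: the convex hull of a finite set of points. -/
def IsPolytope {n : ℕ} (P : Set (EuclideanSpace ℝ (Fin n))) : Prop :=
  ∃ s : Set (EuclideanSpace ℝ (Fin n)), s.Finite ∧ P = convexHull ℝ s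

/-- A lattice polytope: all vertices (i.e. extreme points) lie in `ℤⁿ`. -/
def IsLatticePolytope {n : ℕ} (P : Set (EuclideanSpace ℝ (Fin n))) : Prop :=
  IsPolytope P ∧ P.extremePoints ℝ ⊆ intLattice n

/-- `P` is nonempty and has dimension `d`, i.e. its affine hull has dimension `d`. The ambient
space may have larger dimension. -/
def HasDim {n : ℕ} (P : Set (EuclideanSpace ℝ (Fin n))) (d : ℕ) : Prop :=
  P.Nonempty ∧ Module.finrank ℝ (vectorSpan ℝ P) = d

/-- The segment `[x, y]` is an edge (a one-dimensional face) of `P`; the faces of a polytope are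
the sets on which a linear functional attains its maximum over the polytope. -/
def IsEdge {n : ℕ} (P : Set (EuclideanSpace ℝ (Fin n))) (x y : EuclideanSpace ℝ (Fin n)) : Prop :=
  x ≠ y ∧ IsExposed ℝ P (segment ℝ x y)

/-- A primitive integer vector: its components are coprime. -/
def IsPrimitive {n : ℕ} (u : Fin n → ℤ) : Prop :=
  Finset.univ.gcd u = 1

/-- `ℓ` is the lattice length of the segment `[x, y]`: the ratio of its Euclidean length and that
of the primitive integer vector in the direction of `y - x`. -/
def HasLatticeLength {n : ℕ} (x y : EuclideanSpace ℝ (Fin n)) (ℓ : ℝ) : Prop :=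
  ∃ u : Fin n → ℤ, IsPrimitive u ∧ SameRay ℝ (ofInt u) (y - x) ∧ ℓ = ‖y - x‖ / ‖ofInt u‖

/-- Every edge of `P` has lattice length at least `b`. -/
def EdgesAtLeast {n : ℕ} (P : Set (EuclideanSpace ℝ (Fin n))) (b : ℝ) : Prop :=
  ∀ x y, IsEdge P x y → ∃ ℓ, HasLatticeLength x y ℓ ∧ b ≤ ℓ

/-- `P` is integrally closed: for every positive integer `c`, every lattice point of `c P` is a sum
of `c` lattice points of `P`. -/
def IntegrallyClosed {n : ℕ} (P : Set (EuclideanSpace ℝ (Fin n))) : Prop :=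
  ∀ c : ℕ, 0 < c → ∀ z ∈ (c : ℝ) • P, z ∈ intLattice n →
    ∃ x : Fin c → EuclideanSpace ℝ (Fin n), (∀ i, x i ∈ P ∧ x i ∈ intLattice n) ∧ ∑ i, x i = z

/-- The subgroup of `ℤⁿ` generated by the differences of lattice points of `P`. -/
def differenceLattice {n : ℕ} (P : Set (EuclideanSpace ℝ (Fin n))) :
    AddSubgroup (EuclideanSpace ℝ (Fin n)) :=
  AddSubgroup.closure {w | ∃ x ∈ P, ∃ y ∈ P, x ∈ intLattice n ∧ y ∈ intLattice n ∧ w = x - y}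

/-- `P` is normal: as for integrally closed, but with the lattice affinely generated by the lattice
points of `P` as the lattice of reference. For a lattice point `p` of `P` this affine lattice is
`p + L`, `L` the difference lattice, and its counterpart at the height of `c P` is `c p + L`
(all of these are `L` itself if `0` is a lattice point of `P`). -/
def IsNormal {n : ℕ} (P : Set (EuclideanSpace ℝ (Fin n))) : Prop :=
  ∀ p ∈ P, p ∈ intLattice n →
    ∀ c : ℕ, 0 < c → ∀ z ∈ (c : ℝ) • P, z - (c : ℝ) • p ∈ differenceLattice P →
      ∃ x : Fin c → EuclideanSpace ℝ (Fin n),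
        (∀ i, x i ∈ P ∧ x i - p ∈ differenceLattice P) ∧ ∑ i, x i = z

/-- A simplex: the convex hull of affinely independent points. -/
def IsSimplex {n : ℕ} (P : Set (EuclideanSpace ℝ (Fin n))) : Prop :=
  ∃ (k : ℕ) (v : Fin (k + 1) → EuclideanSpace ℝ (Fin n)),
    AffineIndependent ℝ v ∧ P = convexHull ℝ (Set.range v)

/-- A parallelepiped: a Minkowski sum of segments of linearly independent directions, that is, a
translate of the Minkowski sum of the segments `[0, w i]`, `w` linearly independent. -/
def IsParallelepiped {n : ℕ} (B : Set (EuclideanSpace ℝ (Fin n))) : Prop :=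
  ∃ (k : ℕ) (a : EuclideanSpace ℝ (Fin n)) (w : Fin k → EuclideanSpace ℝ (Fin n)),
    LinearIndependent ℝ w ∧ B = a +ᵥ parallelepiped w

/-- `P` is covered by the lattice parallelepipeds contained in it. -/
def CoveredByLatticeParallelepipeds {n : ℕ} (P : Set (EuclideanSpace ℝ (Fin n))) : Prop :=
  P = ⋃₀ {B | IsParallelepiped B ∧ IsLatticePolytope B ∧ B ⊆ P}

end LatticePolytope

/-! Integral closedness follows once every `p ∈ P` satisfies `2p = x + y` with `x` a lattice point
of `P` and `y ∈ P`: for `z = (c+1)p` a lattice point, `z - x = (c-1)p + y` lies in `cP`, and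
induction on `c` applies. Edge length `d²` suffices for this, so one argument serves (a) and the
last claim of (b).

The decomposition is proved by induction on dimension in the graded form `(1 + j/D)p = x + (j/D)y`
(`exists_lattice_point_decomposition`). If `p` is near the boundary, a ray through `p` soon leaves
`P` at a point `q` of a proper face, and the decomposition of `q` is transferred to `p`. If `p` is
deep inside, round its coordinates in a basis of edge directions (`span_edges`,
`exists_lattice_point_near`): long edges make the rounding error so small against `P - P` that `x`
and the complementary `y` stay in `P`.

For the covering of a simplex, take a vertex with barycentric coordinate at least `1/(d+1)` and tile
from it with boxes along its edges; the box containing `p` is too small to cross the opposite facet.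
-/

namespace LatticePolytope

/-! ### Faces of polytopes as sets of maximizers; edges detect linear functionals. -/

section Faces

variable {E : Type*} [NormedAddCommGroup E] [NormedSpace ℝ E]

/-- The members of `s` at which `f` is maximal. -/
noncomputable def maximizers (s : Finset E) (f : E →L[ℝ] ℝ) : Finset E :=
  open Classical in s.filter fun b => ∀ c ∈ s, f c ≤ f b

lemma mem_maximizers {s : Finset E} {f : E →L[ℝ] ℝ} {b : E} :
    b ∈ maximizers s f ↔ b ∈ s ∧ ∀ c ∈ s, f c ≤ f b := by
  simp [maximizers]

lemma maximizers_subset (s : Finset E) (f : E →L[ℝ] ℝ) : maximizers s f ⊆ s :=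
  fun _ hb => (mem_maximizers.1 hb).1

lemma maximizers_nonempty {s : Finset E} (hs : s.Nonempty) (f : E →L[ℝ] ℝ) :
    (maximizers s f).Nonempty := by
  obtain ⟨b, hb, h⟩ := s.exists_max_image f hs
  exact ⟨b, mem_maximizers.2 ⟨hb, h⟩⟩

lemma apply_le_of_mem_convexHull {s : Set E} {f : E →L[ℝ] ℝ} {m : ℝ} (h : ∀ b ∈ s, f b ≤ m)
    {x : E} (hx : x ∈ convexHull ℝ s) : f x ≤ m :=
  convexHull_min (t := {x | f x ≤ m}) h (convex_halfSpace_le f.isLinear m) hx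

lemma le_apply_of_mem_convexHull {s : Set E} {f : E →L[ℝ] ℝ} {m : ℝ} (h : ∀ b ∈ s, m ≤ f b)
    {x : E} (hx : x ∈ convexHull ℝ s) : m ≤ f x :=
  convexHull_min (t := {x | m ≤ f x}) h (convex_halfSpace_ge f.isLinear m) hx

/-- A convex combination attaining the maximum of `f` has weight zero off the maximizers, because `∑
w b * (f x - f b) = 0` has nonnegative terms. -/
lemma convexHull_maximizers {s : Finset E} (f : E →L[ℝ] ℝ) :
    convexHull ℝ (maximizers s f : Set E) =
      {x ∈ convexHull ℝ (s : Set E) | ∀ y ∈ convexHull ℝ (s : Set E), f y ≤ f x} := by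
  apply Set.Subset.antisymm
  · intro x hx
    refine ⟨convexHull_mono (maximizers_subset s f) hx, fun y hy => ?_⟩
    refine apply_le_of_mem_convexHull (fun b hb => ?_) hy
    exact le_apply_of_mem_convexHull (fun c hc => (mem_maximizers.1 hc).2 b hb) hx
  · rintro x ⟨hx, hmax⟩
    obtain ⟨w, hw0, hw1, hwx⟩ := Finset.mem_convexHull'.1 hx
    have hle : ∀ b ∈ s, f b ≤ f x := fun b hb => hmax b (subset_convexHull ℝ _ hb)
    have hsum : ∑ b ∈ s, w b * (f x - f b) = 0 := by
      simp only [mul_sub, Finset.sum_sub_distrib, ← Finset.sum_mul, hw1]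
      have : f x = ∑ b ∈ s, w b * f b := by rw [← hwx]; simp
      rw [one_mul, ← this, sub_self]
    have hz := (Finset.sum_eq_zero_iff_of_nonneg
      fun b hb => mul_nonneg (hw0 b hb) (sub_nonneg.2 (hle b hb))).1 hsum
    have hsupp : ∀ b ∈ s, b ∉ maximizers s f → w b = 0 := by
      intro b hb hbm
      rcases mul_eq_zero.1 (hz b hb) with h | h
      · exact h
      · refine absurd (mem_maximizers.2 ⟨hb, fun c hc => ?_⟩) hbm
        linarith [hle c hc]
    refine Finset.mem_convexHull'.2 ⟨w, fun b hb => hw0 b (maximizers_subset s f hb), ?_, ?_⟩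
    · rw [← hw1]
      exact Finset.sum_subset (maximizers_subset s f) hsupp
    · rw [← hwx]
      exact Finset.sum_subset (maximizers_subset s f) fun b hb hbm => by simp [hsupp b hb hbm]

lemma isExposed_convexHull_maximizers (s : Finset E) (f : E →L[ℝ] ℝ) :
    IsExposed ℝ (convexHull ℝ (s : Set E)) (convexHull ℝ (maximizers s f : Set E)) :=
  fun _ => ⟨f, convexHull_maximizers f⟩

/-- A face of a face of a polytope is a face of the polytope. -/
lemma isExposed_of_isExposed_maximizers {s : Finset E} (f : E →L[ℝ] ℝ) {F : Set E}
    (hF : IsExposed ℝ (convexHull ℝ (maximizers s f : Set E)) F) :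
    IsExposed ℝ (convexHull ℝ (s : Set E)) F := by
  intro hne
  obtain ⟨g, hg⟩ := hF hne
  rw [← convexHull_maximizers g] at hg
  have hs' : (maximizers (maximizers s f) g).Nonempty := by
    rw [hg] at hne
    exact_mod_cast convexHull_nonempty_iff.1 hne
  obtain ⟨a, ha⟩ := hs'
  obtain ⟨haf, hag⟩ := mem_maximizers.1 ha
  obtain ⟨has, hafm⟩ := mem_maximizers.1 haf
  -- Weight `f` so heavily that leaving its face costs more than `g` can gain; then `g` only breaks
  -- ties within the face.
  obtain ⟨M, hM⟩ := (s.image fun b => (g b - g a) / (f a - f b)).exists_le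
  have hM' : ∀ b ∈ s, f b < f a → (M + 1) * f b + g b < (M + 1) * f a + g a := by
    intro b hb hlt
    have h := hM _ (Finset.mem_image_of_mem _ hb)
    rw [div_le_iff₀ (by linarith)] at h
    nlinarith
  have hM'' : ∀ b ∈ maximizers s f, f b = f a := fun b hb =>
    le_antisymm (hafm b (maximizers_subset s f hb)) ((mem_maximizers.1 hb).2 a has)
  have hle : ∀ b ∈ s, (M + 1) * f b + g b ≤ (M + 1) * f a + g a := by
    intro b hb
    rcases (hafm b hb).lt_or_eq with h | h
    · exact (hM' b hb h).le
    · rw [h]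
      have : g b ≤ g a := hag b (mem_maximizers.2 ⟨hb, by rw [h]; exact hafm⟩)
      linarith
  have key : maximizers s ((M + 1) • f + g) = maximizers (maximizers s f) g := by
    ext b
    rw [mem_maximizers, mem_maximizers]
    simp only [add_apply, smul_apply, smul_eq_mul]
    constructor
    · rintro ⟨hb, h⟩
      have hba := h a has
      have hfb : f b = f a := by
        rcases (hafm b hb).lt_or_eq with h' | h'
        · linarith [hM' b hb h']
        · exact h'
      refine ⟨mem_maximizers.2 ⟨hb, by rw [hfb]; exact hafm⟩, fun c hc => ?_⟩
      have := hag c hc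
      rw [hfb] at hba
      linarith
    · rintro ⟨hb, h⟩
      refine ⟨maximizers_subset s f hb, fun c hc => ?_⟩
      have := hle c hc
      rw [hM'' b hb]
      linarith [h a haf]
  exact ⟨(M + 1) • f + g, by rw [← convexHull_maximizers, key, hg]⟩

/-- A linear functional that is not constant on a polytope is not constant on some edge. -/
lemma exists_edge_apply_ne (φ : E →L[ℝ] ℝ) : ∀ s : Finset E, (∃ a ∈ s, ∃ b ∈ s, φ a ≠ φ b) →
    ∃ x ∈ s, ∃ y ∈ s, IsExposed ℝ (convexHull ℝ (s : Set E)) (segment ℝ x y) ∧ φ x ≠ φ y := by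
  intro s
  induction s using Finset.strongInduction with
  | H s ih =>
  rintro ⟨a₀, ha₀, b₀, hb₀, hab⟩
  -- Either some `ψ` is independent of `φ` on `s`, and a proper face on which `φ` still varies is
  -- found, or `s` is collinear.
  by_cases hψ : ∃ ψ : E →L[ℝ] ℝ, ∀ α : ℝ, ∃ a ∈ s, ∃ b ∈ s, (α • φ + ψ) a ≠ (α • φ + ψ) b
  · obtain ⟨ψ, hψ⟩ := hψ
    obtain ⟨a, ha, hamax⟩ := (maximizers s φ).exists_max_image ψ (maximizers_nonempty ⟨a₀, ha₀⟩ φ)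
    obtain ⟨has, haφ⟩ := mem_maximizers.1 ha
    classical
    have hne : (s.filter fun b => φ b < φ a).Nonempty := by
      rcases hab.lt_or_gt with h | h
      · exact ⟨a₀, Finset.mem_filter.2 ⟨ha₀, h.trans_le (haφ _ hb₀)⟩⟩
      · exact ⟨b₀, Finset.mem_filter.2 ⟨hb₀, h.trans_le (haφ _ ha₀)⟩⟩
    obtain ⟨b, hb, hbmax⟩ := (s.filter fun b => φ b < φ a).exists_max_image
      (fun b => (ψ b - ψ a) / (φ a - φ b)) hne
    obtain ⟨hbs, hbφ⟩ := Finset.mem_filter.1 hb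
    -- In the planar image under `(φ, ψ)`, this slope makes `α • φ + ψ` maximal along a polygon edge
    -- from the extreme point `a` to `b`.
    set α := (ψ b - ψ a) / (φ a - φ b) with hα
    have hmax : ∀ c ∈ s, α * φ c + ψ c ≤ α * φ a + ψ a := by
      intro c hc
      rcases (haφ c hc).lt_or_eq with h | h
      · have := hbmax c (Finset.mem_filter.2 ⟨hc, h⟩)
        rw [div_le_iff₀ (by linarith)] at this
        linarith
      · rw [h]
        have := hamax c (mem_maximizers.2 ⟨hc, by rw [h]; exact haφ⟩)
        linarith
    have heq : α * φ b + ψ b = α * φ a + ψ a := by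
      have : α * (φ a - φ b) = ψ b - ψ a := div_mul_cancel₀ _ (by linarith)
      linarith
    have hssub : maximizers s (α • φ + ψ) ⊂ s := by
      refine (maximizers_subset _ _).ssubset_of_ne fun h => ?_
      obtain ⟨c, hc, e, he, hce⟩ := hψ α
      rw [← h] at hc he
      exact hce (le_antisymm ((mem_maximizers.1 he).2 c (maximizers_subset _ _ hc))
        ((mem_maximizers.1 hc).2 e (maximizers_subset _ _ he)))
    obtain ⟨x, hx, y, hy, hxy, hne⟩ := ih _ hssub ⟨a, mem_maximizers.2 ⟨has, by simpa using hmax⟩,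
      b, mem_maximizers.2 ⟨hbs, by simpa [heq] using hmax⟩, hbφ.ne'⟩
    exact ⟨x, maximizers_subset _ _ hx, y, maximizers_subset _ _ hy,
      isExposed_of_isExposed_maximizers _ hxy, hne⟩
  -- Every functional is now an affine function of `φ` on `s`. Since functionals separate points,
  -- the hull is the segment between the extremes of `φ`, itself the edge sought.
  · push Not at hψ
    obtain ⟨x, hx, hxmin⟩ := s.exists_min_image φ ⟨a₀, ha₀⟩
    obtain ⟨y, hy, hymax⟩ := s.exists_max_image φ ⟨a₀, ha₀⟩
    have hxy : φ x < φ y := by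
      rcases hab.lt_or_gt with h | h
      · linarith [hxmin a₀ ha₀, hymax b₀ hb₀]
      · linarith [hxmin b₀ hb₀, hymax a₀ ha₀]
    refine ⟨x, hx, y, hy, ?_, hxy.ne⟩
    have : segment ℝ x y = convexHull ℝ (s : Set E) := by
      apply Set.Subset.antisymm
      · rw [← convexHull_pair]
        exact convexHull_mono (by simp [Set.insert_subset_iff, hx, hy])
      · refine convexHull_min (fun c hc => ?_) (convex_segment x y)
        have hd : 0 < φ y - φ x := by linarith
        set t := (φ c - φ x) / (φ y - φ x) with ht
        have ht' : t * (φ y - φ x) = φ c - φ x := div_mul_cancel₀ _ hd.ne'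
        have hc' : c = x + t • (y - x) := by
          by_contra hcne
          obtain ⟨ψ, hψne⟩ := SeparatingDual.exists_separating_of_ne (R := ℝ) hcne
          refine hψne ?_
          obtain ⟨α, hα⟩ := hψ ψ
          have h1 := hα c hc x hx
          have h2 := hα y hy x hx
          simp only [add_apply, smul_apply,
            smul_eq_mul] at h1 h2
          have h3 : ψ y - ψ x = -α * (φ y - φ x) := by linarith
          simp only [map_add, map_smul, map_sub, smul_eq_mul, h3]
          linear_combination h1 + α * ht'
        rw [segment_eq_image']
        exact ⟨t, ⟨div_nonneg (by linarith [hxmin c hc]) hd.le,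
          (div_le_one hd).2 (by linarith [hymax c hc])⟩, hc'.symm⟩
    rw [this]

end Faces

/-! ### Splitting a point of a polytope into a lattice point and a remainder. -/

section Decomposition

variable {E : Type*} [NormedAddCommGroup E] [NormedSpace ℝ E]

lemma vectorSpan_convexHull (s : Set E) : vectorSpan ℝ (convexHull ℝ s) = vectorSpan ℝ s := by
  rw [← direction_affineSpan, affineSpan_convexHull, direction_affineSpan]

/-- A symmetric convex set behaves like the unit ball of a seminorm; this is its triangle
inequality, used for `K = P - P`. -/
lemma sum_smul_mem_smul_of_neg_mem {K : Set E} (hK : Convex ℝ K) (h0 : (0 : E) ∈ K)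
    (hneg : ∀ x ∈ K, -x ∈ K) {ι : Type*} (b : Finset ι) (c : ι → ℝ) (k : ι → E)
    (hk : ∀ i ∈ b, k i ∈ K) : ∑ i ∈ b, c i • k i ∈ (∑ i ∈ b, |c i|) • K := by
  classical
  induction b using Finset.induction_on with
  | empty => exact ⟨0, h0, by simp⟩
  | insert i b hi ih =>
    rw [Finset.sum_insert hi, Finset.sum_insert hi,
      hK.add_smul (abs_nonneg _) (Finset.sum_nonneg fun _ _ => abs_nonneg _)]
    refine Set.add_mem_add ?_ (ih fun j hj => hk j (Finset.mem_insert_of_mem hj))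
    have hki := hk i (Finset.mem_insert_self i b)
    rcases abs_choice (c i) with h | h
    · rw [h]; exact Set.smul_mem_smul_set hki
    · exact ⟨-k i, hneg _ hki, by simp [h]⟩

lemma sum_smul_mem_of_neg_mem {K : Set E} (hK : Convex ℝ K) (h0 : (0 : E) ∈ K)
    (hneg : ∀ x ∈ K, -x ∈ K) {ι : Type*} (b : Finset ι) (c : ι → ℝ) (k : ι → E)
    (hk : ∀ i ∈ b, k i ∈ K) (hc : ∑ i ∈ b, |c i| ≤ 1) : ∑ i ∈ b, c i • k i ∈ K := by
  obtain ⟨x, hx, hxe⟩ := sum_smul_mem_smul_of_neg_mem hK h0 hneg b c k hk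
  rw [← hxe]
  exact hK.smul_mem_of_zero_mem h0 hx ⟨Finset.sum_nonneg fun _ _ => abs_nonneg _, hc⟩

/-- A point of a convex set at which a ray from another point of the set leaves the set lies on a
proper face. -/
lemma exists_supporting_functional [FiniteDimensional ℝ E] {P : Set E} (hP : Convex ℝ P) {v q : E}
    (hv : v ∈ P) (hq : q ∈ P) {ε : ℝ} (hε : 0 < ε)
    (hout : ∀ t, 1 < t → t < 1 + ε → v + t • (q - v) ∉ P) :
    ∃ f : E →L[ℝ] ℝ, (∀ y ∈ P, f y ≤ f q) ∧ ∃ y ∈ P, f y < f q := by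
  -- `P` may have empty interior in `E`, so it is translated by `v` into its direction space, where
  -- it has interior points to separate from `q - v`.
  set V := vectorSpan ℝ P with hV
  set Q : Set V := {w | v + w ∈ P} with hQ
  have hQc : Convex ℝ Q := by
    intro x hx y hy a b ha hb hab
    have := hP hx hy ha hb hab
    have e : v + ((a • x + b • y : V) : E) = a • (v + x) + b • (v + y) := by
      have : v = a • v + b • v := by rw [← add_smul, hab, one_smul]
      push_cast
      nth_rw 1 [this]
      module
    simpa only [hQ, Set.mem_ofPred_eq, e] using this
  have h0 : (0 : V) ∈ Q := by simpa [hQ] using hv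
  have hmem : ∀ y ∈ P, y - v ∈ V := fun y hy => vsub_mem_vectorSpan ℝ hy hv
  have himg : ((↑) : V → E) '' Q = (fun y => y -ᵥ v) '' P := by
    ext z
    constructor
    · rintro ⟨w, hw, rfl⟩
      exact ⟨v + w, hw, by simp⟩
    · rintro ⟨y, hy, rfl⟩
      exact ⟨⟨y - v, hmem y hy⟩, by simpa [hQ] using hy, rfl⟩
  have hspan : Submodule.span ℝ Q = ⊤ := by
    apply Submodule.map_injective_of_injective V.subtype_injective
    rw [Submodule.map_span, Submodule.map_top, Submodule.range_subtype]
    change Submodule.span ℝ (((↑) : V → E) '' Q) = V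
    rw [himg, hV, vectorSpan_eq_span_vsub_set_right ℝ hv]
  have hint : (interior Q).Nonempty := by
    rw [hQc.interior_nonempty_iff_affineSpan_eq_top,
      AffineSubspace.affineSpan_eq_top_iff_vectorSpan_eq_top_of_nonempty _ _ _ ⟨0, h0⟩,
      vectorSpan_eq_span_vsub_set_right ℝ h0]
    simpa using hspan
  set q' : V := ⟨q - v, hmem q hq⟩ with hq'
  have hq'int : q' ∉ interior Q := by
    intro hmem'
    have hcont : Filter.Tendsto (fun t : ℝ => t • q') (nhds 1) (nhds q') := by
      have : Continuous fun t : ℝ => t • q' := by fun_prop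
      simpa using this.tendsto 1
    have hev : ∀ᶠ t : ℝ in nhdsWithin 1 (Set.Ioi 1), t • q' ∈ Q :=
      nhdsWithin_le_nhds (hcont (mem_interior_iff_mem_nhds.1 hmem'))
    obtain ⟨t, ht, ht'⟩ := (hev.and (Ioo_mem_nhdsGT (show (1 : ℝ) < 1 + ε by linarith))).exists
    exact hout t ht'.1 ht'.2 ht
  obtain ⟨f, hf⟩ := geometric_hahn_banach_open_point hQc.interior isOpen_interior hq'int
  obtain ⟨g, hg, -⟩ := exists_extension_norm_eq V f
  have hgv : ∀ w : V, g (v + w) = g v + f w := fun w => by rw [map_add, hg]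
  have hgq : g q = g v + f q' := by rw [← hgv]; simp [hq']
  refine ⟨g, fun y hy => ?_, ?_⟩
  · have hyQ : (⟨y - v, hmem y hy⟩ : V) ∈ closure (interior Q) := by
      rw [hQc.closure_interior_eq_closure_of_nonempty_interior hint]
      exact subset_closure (by simpa [hQ] using hy)
    have hle : closure (interior Q) ⊆ {w | f w ≤ f q'} :=
      closure_minimal (fun w hw => (hf w hw).le) (isClosed_le f.continuous continuous_const)
    have h1 := hgv ⟨y - v, hmem y hy⟩
    have h2 := hle hyQ
    simp only [add_sub_cancel] at h1
    rw [h1, hgq]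
    simpa using h2
  · obtain ⟨w, hw⟩ := hint
    have hwQ : w ∈ Q := interior_subset hw
    refine ⟨v + w, hwQ, ?_⟩
    rw [hgv, hgq]
    linarith [hf w hw]

/-- The ray from `v` through `p` leaves a compact convex set in a point of a proper face. -/
lemma exists_exit_point [FiniteDimensional ℝ E] {P : Set E} (hP : Convex ℝ P) (hPc : IsCompact P)
    {v p : E} (hv : v ∈ P) (hp : p ∈ P) {ρ : ℝ} (hρ : 1 ≤ ρ) (hout : v + ρ • (p - v) ∉ P) :
    ∃ τ, 1 ≤ τ ∧ τ ≤ ρ ∧ v + τ • (p - v) ∈ P ∧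
      ∃ f : E →L[ℝ] ℝ, (∀ y ∈ P, f y ≤ f (v + τ • (p - v))) ∧
        ∃ y ∈ P, f y < f (v + τ • (p - v)) := by
  have hcont : Continuous fun t : ℝ => v + t • (p - v) := by fun_prop
  have hcomp : IsCompact (Set.Icc 1 ρ ∩ (fun t : ℝ => v + t • (p - v)) ⁻¹' P) :=
    isCompact_Icc.inter_right (hPc.isClosed.preimage hcont)
  obtain ⟨τ, ⟨hτ, hτP⟩, hmax⟩ := hcomp.exists_isGreatest ⟨1, ⟨le_rfl, hρ⟩, by simpa using hp⟩
  have hτρ : τ < ρ := lt_of_le_of_ne hτ.2 fun h => hout (h ▸ hτP)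
  have hτ0 : 0 < τ := by linarith [hτ.1]
  -- This `ε` satisfies `(1 + ε) * τ = ρ`, so beyond `τ` the ray is tested only below `ρ`, where
  -- maximality of `τ` applies.
  refine ⟨τ, hτ.1, hτ.2, hτP, exists_supporting_functional hP hv hτP
    (ε := (ρ - τ) / τ) (div_pos (by linarith) hτ0) fun t ht1 ht2 hmem => ?_⟩
  rw [add_sub_cancel_left, smul_smul] at hmem
  have h1 : t * τ < ρ := by
    have : (1 + (ρ - τ) / τ) * τ = ρ := by field_simp; ring
    nlinarith
  have h2 : τ < t * τ := by nlinarith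
  exact absurd (hmax ⟨⟨by linarith [hτ.1], h1.le⟩, hmem⟩) (not_le.2 h2)

/-- The edge directions of a polytope span its direction space. -/
lemma span_edges [FiniteDimensional ℝ E] (s : Finset E) :
    vectorSpan ℝ (s : Set E) ≤ Submodule.span ℝ {e | ∃ x ∈ s, ∃ y ∈ s, x ≠ y ∧
      IsExposed ℝ (convexHull ℝ (s : Set E)) (segment ℝ x y) ∧ e = y - x} := by
  intro w hw
  by_contra hcon
  -- A functional vanishing on all edge directions is constant on every edge, hence on the whole
  -- polytope.
  obtain ⟨φ, hφw, hφ⟩ := Submodule.exists_le_ker_of_notMem hcon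
  have hker : ∀ z ∈ vectorSpan ℝ (s : Set E), φ z = 0 := by
    intro z hz
    by_contra hz0
    have hne : ∃ a ∈ s, ∃ b ∈ s, φ.toContinuousLinearMap a ≠ φ.toContinuousLinearMap b := by
      by_contra hall
      push Not at hall
      have : vectorSpan ℝ (s : Set E) ≤ LinearMap.ker φ := by
        refine Submodule.span_le.2 ?_
        rintro _ ⟨a, ha, b, hb, rfl⟩
        have := hall a ha b hb
        simp only [LinearMap.coe_toContinuousLinearMap'] at this
        simp [this]
      exact hz0 (this hz)
    obtain ⟨x, hx, y, hy, hxy, hn⟩ := exists_edge_apply_ne φ.toContinuousLinearMap s hne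
    simp only [LinearMap.coe_toContinuousLinearMap'] at hn
    have := hφ (Submodule.subset_span ⟨x, hx, y, hy, fun h => hn (by rw [h]), hxy, rfl⟩)
    rw [LinearMap.mem_ker, map_sub] at this
    exact hn (by linarith)
  exact hφw (hker w hw)

lemma finrank_vectorSpan_maximizers_lt [FiniteDimensional ℝ E] {s : Finset E} {f : E →L[ℝ] ℝ}
    {a b : E} (ha : a ∈ s) (hb : b ∈ s) (hab : f a < f b) :
    Module.finrank ℝ (vectorSpan ℝ (maximizers s f : Set E)) <
      Module.finrank ℝ (vectorSpan ℝ (s : Set E)) := by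
  refine Submodule.finrank_lt_finrank_of_lt
    (lt_of_le_of_ne (vectorSpan_mono ℝ (maximizers_subset s f)) fun h => ?_)
  have hker : vectorSpan ℝ (maximizers s f : Set E) ≤ LinearMap.ker (f : E →ₗ[ℝ] ℝ) := by
    refine Submodule.span_le.2 ?_
    rintro _ ⟨c, hc, e, he, rfl⟩
    have h1 := (mem_maximizers.1 hc).2 e (maximizers_subset _ _ he)
    have h2 := (mem_maximizers.1 he).2 c (maximizers_subset _ _ hc)
    simp [le_antisymm h1 h2]
  have hmem : a - b ∈ vectorSpan ℝ (s : Set E) := vsub_mem_vectorSpan ℝ ha hb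
  rw [← h] at hmem
  have := hker hmem
  simp only [LinearMap.mem_ker, ContinuousLinearMap.coe_coe, map_sub] at this
  linarith

/-- If `p + ε (P - P) ⊆ P` and the edges of `P` are long multiples of lattice vectors, then there is
a lattice point so close to `p` that its displacement is small compared with `P - P`. -/
lemma exists_lattice_point_near [FiniteDimensional ℝ E] {L : AddSubgroup E} {N : ℝ} (hN : 0 < N)
    {s : Finset E} (hsL : (s : Set E) ⊆ L)
    (hs : ∀ x y, x ≠ y → IsExposed ℝ (convexHull ℝ (s : Set E)) (segment ℝ x y) →
      ∃ u ∈ L, ∃ ℓ, N ≤ ℓ ∧ y - x = ℓ • u)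
    {p : E} (hp : p ∈ convexHull ℝ (s : Set E)) :
    ∃ x ∈ L, ∀ r : ℝ, |r| * Module.finrank ℝ (vectorSpan ℝ (s : Set E)) ≤ 2 * N →
      ∃ y ∈ convexHull ℝ (s : Set E), ∃ z ∈ convexHull ℝ (s : Set E), r • (x - p) = z - y := by
  set P := convexHull ℝ (s : Set E) with hPdef
  set T := {e | ∃ x ∈ s, ∃ y ∈ s, x ≠ y ∧ IsExposed ℝ P (segment ℝ x y) ∧ e = y - x} with hT
  have hPc : Convex ℝ P := convex_convexHull ℝ _
  obtain ⟨v, hv⟩ : s.Nonempty := by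
    exact_mod_cast convexHull_nonempty_iff.1 ⟨p, hp⟩
  have hvP : v ∈ P := subset_convexHull ℝ _ hv
  have hTspan : Submodule.span ℝ T ≤ vectorSpan ℝ (s : Set E) := by
    refine Submodule.span_le.2 ?_
    rintro _ ⟨x, hx, y, hy, -, -, rfl⟩
    exact vsub_mem_vectorSpan ℝ hy hx
  obtain ⟨b, hbT, hbspan, hbli⟩ := exists_linearIndependent ℝ T
  have hbfin : b.Finite := hbli.setFinite
  lift b to Finset E using hbfin
  have hcard : (b.card : ℝ) ≤ Module.finrank ℝ (vectorSpan ℝ (s : Set E)) := by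
    have h1 : Module.finrank ℝ (Submodule.span ℝ (b : Set E)) = b.card :=
      finrank_span_finset_eq_card hbli
    rw [← h1, hbspan]
    exact_mod_cast Submodule.finrank_mono hTspan
  have hpv : p - v ∈ Submodule.span ℝ (b : Set E) := by
    rw [hbspan]
    refine span_edges s ?_
    rw [← vectorSpan_convexHull]
    exact vsub_mem_vectorSpan ℝ hp hvP
  obtain ⟨t, -, ht⟩ := Submodule.mem_span_finset.1 hpv
  have hu : ∀ e : E, ∃ u ∈ L, ∃ ℓ, N ≤ ℓ ∧ (e ∈ b → e = ℓ • u) := by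
    intro e
    by_cases he : e ∈ b
    · obtain ⟨x, -, y, -, hxy, hex, rfl⟩ := hbT he
      obtain ⟨u, hu, ℓ, hℓ, h⟩ := hs x y hxy hex
      exact ⟨u, hu, ℓ, hℓ, fun _ => h⟩
    · exact ⟨0, L.zero_mem, N, le_rfl, fun h => absurd h he⟩
  choose u huL ℓ hℓ hul using hu
  have hℓ0 : ∀ e, 0 < ℓ e := fun e => hN.trans_le (hℓ e)
  -- The coordinate of `p - v` along `e = ℓ e • u e` is rounded to a multiple of `1 / ℓ e`; the
  -- error `c e` is at most `1 / (2N)`.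
  set c : E → ℝ := fun e => ((round (t e * ℓ e) : ℝ) - t e * ℓ e) / ℓ e with hc
  refine ⟨v + ∑ e ∈ b, round (t e * ℓ e) • u e, L.add_mem (hsL hv)
    (L.sum_mem fun e _ => L.zsmul_mem (huL e) _), fun r hr => ?_⟩
  have hxp : v + ∑ e ∈ b, round (t e * ℓ e) • u e - p = ∑ e ∈ b, c e • e := by
    have h1 : v - p = -∑ e ∈ b, t e • e := by rw [ht]; abel
    rw [add_sub_right_comm, h1, neg_add_eq_sub, ← Finset.sum_sub_distrib]
    refine Finset.sum_congr rfl fun e he => ?_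
    have h2 : c e • e = ((round (t e * ℓ e) : ℝ) - t e * ℓ e) • u e := by
      conv_lhs => rw [hul e he, smul_smul]
      rw [hc, ← hul e he]
      congr 1
      exact div_mul_cancel₀ _ (hℓ0 e).ne'
    have h3 : t e • e = (t e * ℓ e) • u e := by
      conv_lhs => rw [hul e he, smul_smul]
      rw [← hul e he]
    rw [h2, h3, sub_smul, Int.cast_smul_eq_zsmul]
  have hcle : ∀ e, |c e| ≤ 1 / (2 * N) := by
    intro e
    rw [hc, abs_div, abs_of_pos (hℓ0 e), abs_sub_comm, div_le_div_iff₀ (hℓ0 e) (by linarith)]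
    have := abs_sub_round (t e * ℓ e)
    nlinarith [hℓ e, abs_nonneg (t e * ℓ e - round (t e * ℓ e))]
  have hmem : ∑ e ∈ b, (r * c e) • e ∈ P - P := by
    refine sum_smul_mem_of_neg_mem (hPc.sub hPc) ⟨v, hvP, v, hvP, sub_self v⟩ ?_ b _ _ ?_ ?_
    · rintro _ ⟨y, hy, z, hz, rfl⟩
      exact ⟨z, hz, y, hy, by simp⟩
    · intro e he
      obtain ⟨x, hx, y, hy, -, -, rfl⟩ := hbT he
      exact ⟨y, subset_convexHull ℝ _ hy, x, subset_convexHull ℝ _ hx, rfl⟩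
    · calc ∑ e ∈ b, |r * c e| ≤ ∑ e ∈ b, |r| * (1 / (2 * N)) :=
            Finset.sum_le_sum fun e _ => by
              rw [abs_mul]; exact mul_le_mul_of_nonneg_left (hcle e) (abs_nonneg r)
        _ = |r| * b.card / (2 * N) := by rw [Finset.sum_const, nsmul_eq_mul]; ring
        _ ≤ 1 := by
            rw [div_le_one (by linarith)]
            exact (mul_le_mul_of_nonneg_left hcard (abs_nonneg r)).trans hr
  obtain ⟨z, hz, y, hy, hzy⟩ := hmem
  refine ⟨y, hy, z, hz, ?_⟩
  rw [hxp, Finset.smul_sum]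
  simp only [smul_smul]
  exact hzy.symm

/-- In a lattice polytope of dimension at most `j ≤ D` whose edges have lattice length at least
`D ^ 2`, every point multiplied by `1 + j / D` is a lattice point of the polytope plus `j / D` times
a point of the polytope. -/
lemma exists_lattice_point_decomposition [FiniteDimensional ℝ E] {L : AddSubgroup E} {D : ℕ} {N : ℝ}
    (hN : (D : ℝ) ^ 2 ≤ N) (j : ℕ) : j ≤ D → ∀ s : Finset E, (s : Set E) ⊆ L →
    (∀ x y, x ≠ y → IsExposed ℝ (convexHull ℝ (s : Set E)) (segment ℝ x y) →
      ∃ u ∈ L, ∃ ℓ, N ≤ ℓ ∧ y - x = ℓ • u) →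
    Module.finrank ℝ (vectorSpan ℝ (s : Set E)) ≤ j → ∀ p ∈ convexHull ℝ (s : Set E),
    ∃ x ∈ convexHull ℝ (s : Set E), x ∈ L ∧ ∃ y ∈ convexHull ℝ (s : Set E),
      (1 + j / D : ℝ) • p = x + (j / D : ℝ) • y := by
  induction j with
  | zero =>
    intro _ s hsL _ hdim p hp
    have hbot : vectorSpan ℝ (s : Set E) = ⊥ := Submodule.finrank_eq_zero.1 (by lia)
    obtain ⟨v, hv⟩ := convexHull_nonempty_iff.1 ⟨p, hp⟩
    have hpv : p = v := by
      have : p - v ∈ vectorSpan ℝ (convexHull ℝ (s : Set E)) :=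
        vsub_mem_vectorSpan ℝ hp (subset_convexHull ℝ _ hv)
      rw [vectorSpan_convexHull, hbot, Submodule.mem_bot] at this
      exact sub_eq_zero.1 this
    exact ⟨p, hp, hpv ▸ hsL hv, p, hp, by simp⟩
  | succ j ih =>
    intro hjD s hsL hs hdim p hp
    have hD : (1 : ℝ) ≤ D := by exact_mod_cast (by lia : 1 ≤ D)
    have hD0 : (0 : ℝ) < D := by linarith
    have hj0 : (0 : ℝ) ≤ j := j.cast_nonneg
    have hjD' : (j : ℝ) + 1 ≤ D := by exact_mod_cast hjD
    have hPc : Convex ℝ (convexHull ℝ (s : Set E)) := convex_convexHull ℝ _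
    push_cast
    -- The ratio is `(1 + (j+1)/D) / (1 + j/D)`, the largest stretch for which a decomposition at
    -- level `j` still transfers to level `j + 1`.
    by_cases hA : ∃ v ∈ convexHull ℝ (s : Set E),
        v + ((D + j + 1) / (D + j) : ℝ) • (p - v) ∉ convexHull ℝ (s : Set E)
    · obtain ⟨v, hv, hvout⟩ := hA
      obtain ⟨τ, hτ1, hτ2, hq, f, hfmax, y, hy, hfy⟩ := exists_exit_point hPc
        (s.finite_toSet.isCompact_convexHull ℝ) hv hp
        (by rw [le_div_iff₀ (by linarith)]; linarith) hvout
      set q := v + τ • (p - v) with hqdef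
      have hqt : q ∈ convexHull ℝ (maximizers s f : Set E) := by
        rw [convexHull_maximizers]
        exact ⟨hq, hfmax⟩
      have hlt : Module.finrank ℝ (vectorSpan ℝ (maximizers s f : Set E)) <
          Module.finrank ℝ (vectorSpan ℝ (s : Set E)) := by
        obtain ⟨b, hb⟩ := convexHull_nonempty_iff.1 ⟨q, hqt⟩
        have hfb : f q ≤ f b :=
          apply_le_of_mem_convexHull (fun c hc => (mem_maximizers.1 hb).2 c hc) hq
        obtain ⟨a, ha, hab⟩ : ∃ a ∈ s, f a < f b := by
          by_contra hall
          push Not at hall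
          have := le_apply_of_mem_convexHull (fun c hc => hall c hc) hy
          linarith
        exact finrank_vectorSpan_maximizers_lt ha (maximizers_subset _ _ hb) hab
      have hsub : convexHull ℝ (maximizers s f : Set E) ⊆ convexHull ℝ (s : Set E) :=
        convexHull_mono (maximizers_subset s f)
      obtain ⟨x, hx, hxL, y', hy', hxy⟩ := ih (by lia) (maximizers s f)
        (Set.Subset.trans (maximizers_subset s f) hsL)
        (fun x y hxy he => hs x y hxy (isExposed_of_isExposed_maximizers f he)) (by lia) q hqt
      have hτ0 : 0 < τ := by linarith
      have hpq : p = (1 - 1 / τ) • v + (1 / τ) • q := by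
        have : (1 / τ) • q = (1 / τ) • v + p - v := by
          rw [hqdef, smul_add, smul_smul, one_div_mul_cancel hτ0.ne']
          module
        rw [this]
        module
      have hα : 0 ≤ (1 + (j + 1) / D : ℝ) * (1 - 1 / τ) := by
        refine mul_nonneg (by positivity) ?_
        rw [sub_nonneg, div_le_one hτ0]
        exact hτ1
      -- The decomposition of `q` consumes `(1 + j/D) • q`; the bound on `τ` ensures that this much
      -- is available.
      have hβ : 0 ≤ (1 + (j + 1) / D : ℝ) / τ - (1 + j / D) := by
        rw [sub_nonneg, le_div_iff₀ hτ0]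
        calc (1 + j / D : ℝ) * τ ≤ (1 + j / D) * ((D + j + 1) / (D + j)) :=
              mul_le_mul_of_nonneg_left hτ2 (by positivity)
          _ = 1 + (j + 1) / D := by field_simp; ring
      have hγ : (0 : ℝ) ≤ j / D := by positivity
      have hmem : ((1 + (j + 1) / D : ℝ) * (1 - 1 / τ)) • v +
          ((1 + (j + 1) / D : ℝ) / τ - (1 + j / D)) • q + (j / D : ℝ) • y' ∈
          ((j + 1) / D : ℝ) • convexHull ℝ (s : Set E) := by
        have hsum : ((j + 1) / D : ℝ) = (1 + (j + 1) / D : ℝ) * (1 - 1 / τ) +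
          ((1 + (j + 1) / D : ℝ) / τ - (1 + j / D)) + j / D := by ring
        have hset := hPc.add_smul (add_nonneg hα hβ) hγ
        rw [← hsum, hPc.add_smul hα hβ] at hset
        rw [hset]
        exact Set.add_mem_add (Set.add_mem_add (Set.smul_mem_smul_set hv)
          (Set.smul_mem_smul_set hq)) (Set.smul_mem_smul_set (hsub hy'))
      obtain ⟨z, hz, hze⟩ := hmem
      refine ⟨x, hsub hx, hxL, z, hz, ?_⟩
      simp only at hze
      rw [hze]
      have hx' : x = (1 + j / D : ℝ) • q - (j / D : ℝ) • y' := eq_sub_of_add_eq hxy.symm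
      rw [hx']
      conv_lhs => rw [hpq]
      module
    · push Not at hA
      -- Averaging the stretched point from `y` with `z` shows that `p` has room for `(P - P) / (D +
      -- j + 1)`.
      have hshift : ∀ y ∈ convexHull ℝ (s : Set E), ∀ z ∈ convexHull ℝ (s : Set E),
          p + (1 / (D + j + 1) : ℝ) • (z - y) ∈ convexHull ℝ (s : Set E) := by
        intro y hy z hz
        have h1 : (D + j + 1 : ℝ) ≠ 0 := by positivity
        have h2 : (D + j : ℝ) ≠ 0 := by positivity
        have := hPc (hA y hy) hz (a := (D + j) / (D + j + 1)) (b := 1 / (D + j + 1))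
          (by positivity) (by positivity) (by field_simp)
        convert this using 1
        match_scalars <;> field_simp
        ring
      obtain ⟨x, hxL, hx⟩ := exists_lattice_point_near
        (lt_of_lt_of_le (by positivity) hN) hsL hs hp
      have hdim' : (Module.finrank ℝ (vectorSpan ℝ (s : Set E)) : ℝ) ≤ j + 1 := by
        exact_mod_cast hdim
      -- Since `D + j + 1 ≤ 2D`, one has `(D + j + 1) * |r| * (j + 1) ≤ 2D² ≤ 2N`, as the choice of
      -- `x` requires.
      have hmove : ∀ r : ℝ, |r| * (j + 1) ≤ D →
          p + r • (x - p) ∈ convexHull ℝ (s : Set E) := by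
        intro r hr
        obtain ⟨y, hy, z, hz, h⟩ := hx ((D + j + 1) * r) (by
          rw [abs_mul, abs_of_nonneg (by positivity : (0 : ℝ) ≤ D + j + 1)]
          have h1 := mul_le_mul_of_nonneg_left hdim' (abs_nonneg r)
          nlinarith)
        have := hshift y hy z hz
        rw [← h, smul_smul] at this
        convert this using 3
        field_simp
      -- The value of `y` is forced by the equation; `x` and `y` are the cases `r = 1` and `r = -D /
      -- (j + 1)`.
      refine ⟨x, ?_, hxL, p + (-(D / (j + 1)) : ℝ) • (x - p), ?_, ?_⟩
      · simpa using hmove 1 (by simpa using hjD')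
      · refine hmove _ ?_
        rw [abs_neg, abs_of_nonneg (by positivity), div_mul_cancel₀ _ (by positivity)]
      · match_scalars <;> field_simp <;> ring

end Decomposition

/-! ### From the decomposition to integral closedness and normality. -/

section LatticePolytopes

variable {n : ℕ}

/-- This trades metric lattice length for a multiple of a lattice vector. Primitivity serves only to
make that vector nonzero. -/
lemma EdgesAtLeast.exists_smul {P : Set (EuclideanSpace ℝ (Fin n))} {b : ℝ}
    (h : EdgesAtLeast P b) (x y : EuclideanSpace ℝ (Fin n)) (hxy : x ≠ y)
    (he : IsExposed ℝ P (segment ℝ x y)) :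
    ∃ u ∈ intLattice n, ∃ ℓ, b ≤ ℓ ∧ y - x = ℓ • u := by
  obtain ⟨ℓ, ⟨u, hu, hray, hℓ⟩, hb⟩ := h x y ⟨hxy, he⟩
  refine ⟨ofInt u, fun i => ⟨u i, rfl⟩, ℓ, hb, ?_⟩
  have hne : ofInt u ≠ 0 := by
    intro h0
    have h1 : ∀ i, u i = 0 := fun i => by
      have : (ofInt u) i = 0 := by rw [h0]; rfl
      simpa [ofInt] using this
    have h2 : Finset.univ.gcd u = 0 := Finset.gcd_eq_zero_iff.2 fun i _ => h1 i
    rw [IsPrimitive, h2] at hu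
    exact zero_ne_one hu
  have hn : ‖ofInt u‖ ≠ 0 := norm_ne_zero_iff.2 hne
  have hs := sameRay_iff_norm_smul_eq.1 hray
  rw [hℓ, div_eq_inv_mul, mul_smul, ← hs, smul_smul, inv_mul_cancel₀ hn, one_smul]

/-- By Krein–Milman the vertices, finitely many, already generate `P`. -/
lemma IsLatticePolytope.exists_finset {P : Set (EuclideanSpace ℝ (Fin n))}
    (hP : IsLatticePolytope P) : ∃ s : Finset (EuclideanSpace ℝ (Fin n)),
      (s : Set (EuclideanSpace ℝ (Fin n))) ⊆ intLattice n ∧ P = convexHull ℝ (s : Set _) := by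
  obtain ⟨⟨t, ht, rfl⟩, hext⟩ := hP
  have hfin : ((convexHull ℝ t).extremePoints ℝ).Finite := ht.subset extremePoints_convexHull_subset
  refine ⟨hfin.toFinset, by simpa using hext, ?_⟩
  rw [hfin.coe_toFinset, ← (hfin.isClosed_convexHull ℝ).closure_eq,
    closure_convexHull_extremePoints (ht.isCompact_convexHull ℝ) (convex_convexHull ℝ t)]

lemma integrallyClosed_of_two_smul {P : Set (EuclideanSpace ℝ (Fin n))} (hP : Convex ℝ P)
    (h : ∀ p ∈ P, ∃ x ∈ P, x ∈ intLattice n ∧ ∃ y ∈ P, (2 : ℝ) • p = x + y) :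
    IntegrallyClosed P := by
  intro c hc
  induction c, hc using Nat.le_induction with
  | base =>
    rintro z hz hzL
    exact ⟨fun _ => z, fun _ => ⟨by simpa using hz, hzL⟩, by simp⟩
  | succ c hc ih =>
    rintro _ ⟨p, hp, rfl⟩ hzL
    simp only at hzL ⊢
    obtain ⟨x, hx, hxL, y, hy, hxy⟩ := h p hp
    have hc' : (0 : ℝ) ≤ c - 1 := by
      rw [sub_nonneg]; exact_mod_cast hc
    have hrem : ((c + 1 : ℕ) : ℝ) • p - x = ((c : ℝ) - 1) • p + y := by
      have : x = (2 : ℝ) • p - y := eq_sub_of_add_eq hxy.symm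
      rw [this]
      push_cast
      module
    have hmem : ((c + 1 : ℕ) : ℝ) • p - x ∈ (c : ℝ) • P := by
      have hset := hP.add_smul hc' zero_le_one
      rw [sub_add_cancel, one_smul] at hset
      rw [hrem, hset]
      exact Set.add_mem_add (Set.smul_mem_smul_set hp) hy
    obtain ⟨f, hf, hsum⟩ := ih _ hmem ((intLattice n).sub_mem hzL hxL)
    refine ⟨Fin.cons x f, fun i => ?_, ?_⟩
    · refine Fin.cases ⟨hx, hxL⟩ (fun i => ?_) i
      simpa using hf i
    · rw [Fin.sum_univ_succ]
      simp [hsum]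

lemma integrallyClosed_of_edgesAtLeast {P : Set (EuclideanSpace ℝ (Fin n))} {d : ℕ} {b : ℝ}
    (hP : IsLatticePolytope P) (hd : HasDim P d) (hb : (d : ℝ) ^ 2 ≤ b) (h : EdgesAtLeast P b) :
    IntegrallyClosed P := by
  obtain ⟨s, hsL, rfl⟩ := hP.exists_finset
  have hPc : Convex ℝ (convexHull ℝ (s : Set (EuclideanSpace ℝ (Fin n)))) := convex_convexHull ℝ _
  refine integrallyClosed_of_two_smul hPc fun p hp => ?_
  have hdim : Module.finrank ℝ (vectorSpan ℝ (s : Set (EuclideanSpace ℝ (Fin n)))) ≤ d := by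
    rw [← vectorSpan_convexHull, hd.2]
  obtain ⟨x, hx, hxL, y, hy, hxy⟩ :=
    exists_lattice_point_decomposition hb d le_rfl s hsL h.exists_smul hdim p hp
  -- The quotient `d / d` is `1`, except for `d = 0`, where it is `0`; giving the missing weight to
  -- `p` covers both cases.
  have hle : (d / d : ℝ) ≤ 1 := div_self_le_one _
  have h0 : (0 : ℝ) ≤ d / d := by positivity
  refine ⟨x, hx, hxL, (d / d : ℝ) • y + (1 - d / d : ℝ) • p,
    hPc hy hp h0 (by linarith) (by ring), ?_⟩
  rw [← add_assoc, ← hxy]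
  module

/-- The difference lattice lies in `ℤⁿ`, and every lattice point of `P` differs from `p` by one of
its generators. -/
lemma IntegrallyClosed.isNormal {P : Set (EuclideanSpace ℝ (Fin n))} (h : IntegrallyClosed P) :
    IsNormal P := by
  intro p hp hpL c hc z hz hzp
  have hle : differenceLattice P ≤ intLattice n := by
    refine (AddSubgroup.closure_le _).2 ?_
    rintro _ ⟨x, -, y, -, hx, hy, rfl⟩
    exact (intLattice n).sub_mem hx hy
  have hzL : z ∈ intLattice n := by
    have h1 : (c : ℝ) • p ∈ intLattice n := by
      rw [Nat.cast_smul_eq_nsmul]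
      exact (intLattice n).nsmul_mem hpL c
    simpa using (intLattice n).add_mem (hle hzp) h1
  obtain ⟨x, hx, hsum⟩ := h c hc z hz hzL
  exact ⟨x, fun i => ⟨(hx i).1, AddSubgroup.subset_closure
    ⟨x i, (hx i).1, p, hp, (hx i).2, hpL, rfl⟩⟩, hsum⟩

end LatticePolytopes

/-! ### Vertices, edges and barycentric coordinates of a simplex. -/

section Simplices

variable {E : Type*} [NormedAddCommGroup E] [NormedSpace ℝ E] {k : ℕ} {v : Fin (k + 1) → E}

lemma linearIndependent_succAbove_sub (hv : AffineIndependent ℝ v) (i : Fin (k + 1)) :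
    LinearIndependent ℝ fun j : Fin k => v (i.succAbove j) - v i := by
  have h := (affineIndependent_iff_linearIndependent_vsub ℝ v i).1 hv
  exact h.comp (fun j : Fin k => (⟨i.succAbove j, i.succAbove_ne j⟩ : {x // x ≠ i}))
    fun a b hab => i.succAbove_right_injective (congrArg Subtype.val hab)

/-- The edge vectors at `v i` are linearly independent, so values on them are free. Suitable `c`
expose the vertices and edges of the simplex. -/
lemma exists_functional_vertices [FiniteDimensional ℝ E] (hv : AffineIndependent ℝ v)
    (i : Fin (k + 1)) (c : Fin k → ℝ) :
    ∃ f : E →L[ℝ] ℝ, ∀ j, f (v (i.succAbove j)) = f (v i) + c j := by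
  have hli := linearIndependent_succAbove_sub hv i
  obtain ⟨g, hg⟩ := ((Module.Basis.span hli).constr ℝ c).exists_extend
  refine ⟨g.toContinuousLinearMap, fun j => ?_⟩
  have h1 := LinearMap.congr_fun hg (Module.Basis.span hli j)
  rw [Module.Basis.constr_basis, LinearMap.comp_apply, Submodule.subtype_apply,
    Module.Basis.span_apply, map_sub] at h1
  simp only [LinearMap.coe_toContinuousLinearMap']
  linarith

lemma vertex_mem_extremePoints [FiniteDimensional ℝ E] (hv : AffineIndependent ℝ v)
    (i : Fin (k + 1)) : v i ∈ (convexHull ℝ (Set.range v)).extremePoints ℝ := by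
  classical
  obtain ⟨f, hf⟩ := exists_functional_vertices hv i fun _ => -1
  apply exposedPoints_subset_extremePoints
  rw [mem_exposedPoints_iff_exposed_singleton]
  have h := isExposed_convexHull_maximizers (Finset.univ.image v) f
  have hm : maximizers (Finset.univ.image v) f = {v i} := by
    ext x
    rw [mem_maximizers, Finset.mem_singleton]
    simp only [Finset.mem_image, Finset.mem_univ, true_and, forall_exists_index,
      forall_apply_eq_imp_iff]
    constructor
    · rintro ⟨⟨m, rfl⟩, hmax⟩
      rcases Fin.eq_self_or_eq_succAbove i m with rfl | ⟨j, rfl⟩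
      · rfl
      · linarith [hmax i, hf j]
    · rintro rfl
      refine ⟨⟨i, rfl⟩, fun m => ?_⟩
      rcases Fin.eq_self_or_eq_succAbove i m with rfl | ⟨j, rfl⟩
      · rfl
      · linarith [hf j]
  rw [hm] at h
  simpa using h

lemma isExposed_segment_vertices [FiniteDimensional ℝ E] (hv : AffineIndependent ℝ v)
    (i : Fin (k + 1)) (j : Fin k) :
    IsExposed ℝ (convexHull ℝ (Set.range v)) (segment ℝ (v i) (v (i.succAbove j))) := by
  classical
  obtain ⟨f, hf⟩ := exists_functional_vertices hv i fun l => if l = j then 0 else -1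
  have h := isExposed_convexHull_maximizers (Finset.univ.image v) f
  have hle : ∀ m, f (v m) ≤ f (v i) := fun m => by
    rcases Fin.eq_self_or_eq_succAbove i m with rfl | ⟨l, rfl⟩
    · rfl
    · rw [hf l]
      split_ifs <;> linarith
  have hm : maximizers (Finset.univ.image v) f = {v i, v (i.succAbove j)} := by
    ext x
    rw [mem_maximizers, Finset.mem_insert, Finset.mem_singleton]
    simp only [Finset.mem_image, Finset.mem_univ, true_and, forall_exists_index,
      forall_apply_eq_imp_iff]
    constructor
    · rintro ⟨⟨m, rfl⟩, hmax⟩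
      rcases Fin.eq_self_or_eq_succAbove i m with rfl | ⟨l, rfl⟩
      · exact Or.inl rfl
      · by_cases hl : l = j
        · exact Or.inr (by rw [hl])
        · have h1 := hf l
          rw [if_neg hl] at h1
          linarith [hmax i]
    · rintro (rfl | rfl)
      · exact ⟨⟨i, rfl⟩, hle⟩
      · refine ⟨⟨_, rfl⟩, fun m => ?_⟩
        have h1 := hf j
        rw [if_pos rfl] at h1
        linarith [hle m]
  rw [hm] at h
  simpa [convexHull_pair] using h

lemma exists_weights_of_mem_convexHull_range {ι : Type*} [Fintype ι] {v : ι → E} {p : E}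
    (hp : p ∈ convexHull ℝ (Set.range v)) :
    ∃ w : ι → ℝ, (∀ i, 0 ≤ w i) ∧ ∑ i, w i = 1 ∧ ∑ i, w i • v i = p := by
  classical
  have hsub : convexHull ℝ (Set.range v) ⊆ Fintype.linearCombination ℝ v '' stdSimplex ℝ ι := by
    refine convexHull_min ?_ ((convex_stdSimplex ℝ ι).linear_image _)
    rintro _ ⟨i, rfl⟩
    exact ⟨Pi.single i 1, single_mem_stdSimplex ℝ i, by simp⟩
  obtain ⟨w, hw, rfl⟩ := hsub hp
  exact ⟨w, hw.1, hw.2, by simp [Fintype.linearCombination_apply]⟩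

lemma add_sum_smul_sub_mem_convexHull (i : Fin (k + 1)) (μ : Fin k → ℝ) (h0 : ∀ j, 0 ≤ μ j)
    (h1 : ∑ j, μ j ≤ 1) :
    v i + ∑ j, μ j • (v (i.succAbove j) - v i) ∈ convexHull ℝ (Set.range v) := by
  refine mem_convexHull_of_exists_fintype (i.insertNth (α := fun _ => ℝ) (1 - ∑ j, μ j) μ) v
    (fun m => ?_) ?_ (fun m => Set.mem_range_self m) ?_
  · rcases Fin.eq_self_or_eq_succAbove i m with rfl | ⟨l, rfl⟩
    · simpa using h1
    · simpa using h0 l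
  · rw [Fin.sum_univ_succAbove _ i]
    simp
  · rw [Fin.sum_univ_succAbove _ i]
    simp only [Fin.insertNth_apply_same, Fin.insertNth_apply_succAbove, smul_sub,
      Finset.sum_sub_distrib, ← Finset.sum_smul]
    module

end Simplices

/-! ### Covering a simplex by lattice parallelepipeds. -/

section Covering

variable {n : ℕ}

lemma isLatticePolytope_vadd_parallelepiped {k : ℕ} {a : EuclideanSpace ℝ (Fin n)}
    {w : Fin k → EuclideanSpace ℝ (Fin n)} (ha : a ∈ intLattice n)
    (hw : ∀ j, w j ∈ intLattice n) : IsLatticePolytope (a +ᵥ parallelepiped w) := by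
  have hfin : (∑ j, ({0, w j} : Set (EuclideanSpace ℝ (Fin n)))).Finite :=
    Finset.sum_induction _ Set.Finite (fun _ _ h1 h2 => h1.add h2) (Set.finite_singleton 0)
      fun j _ => Set.toFinite _
  have hsub : ∑ j, ({0, w j} : Set (EuclideanSpace ℝ (Fin n))) ⊆
      (intLattice n : Set (EuclideanSpace ℝ (Fin n))) := by
    refine Finset.sum_induction _ (fun S => S ⊆ (intLattice n : Set (EuclideanSpace ℝ (Fin n)))) ?_ ?_ ?_
    · rintro S T hS hT _ ⟨x, hx, y, hy, rfl⟩
      exact (intLattice n).add_mem (hS hx) (hT hy)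
    · rintro _ rfl
      exact (intLattice n).zero_mem
    · rintro j - _ (rfl | rfl)
      · exact (intLattice n).zero_mem
      · exact hw j
  have heq : a +ᵥ parallelepiped w =
      convexHull ℝ (a +ᵥ ∑ j, ({0, w j} : Set (EuclideanSpace ℝ (Fin n)))) := by
    rw [parallelepiped_eq_convexHull, convexHull_vadd]
  refine ⟨⟨_, hfin.vadd_set, heq⟩, ?_⟩
  rw [heq]
  refine extremePoints_convexHull_subset.trans ?_
  rintro _ ⟨x, hx, rfl⟩
  exact (intLattice n).add_mem ha (hsub hx)

lemma coveredByLatticeParallelepipeds_of_isSimplex {P : Set (EuclideanSpace ℝ (Fin n))} {d : ℕ}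
    (hP : IsLatticePolytope P) (hd : HasDim P d) (hs : IsSimplex P)
    (h : EdgesAtLeast P ((d : ℝ) * (d + 1))) : CoveredByLatticeParallelepipeds P := by
  obtain ⟨k, v, hv, rfl⟩ := hs
  obtain rfl : k = d := by
    rw [← hd.2, vectorSpan_convexHull, hv.finrank_vectorSpan (Fintype.card_fin _)]
  apply Set.Subset.antisymm _ (Set.sUnion_subset fun B hB => hB.2.2)
  intro p hp
  obtain ⟨c, hc0, hc1, rfl⟩ := exists_weights_of_mem_convexHull_range hp
  -- The barycentric coordinates sum to `1`, so one of the `k + 1` is at least the average. The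
  -- slack `c i` at this vertex absorbs the size of the box.
  obtain ⟨i, -, hi⟩ : ∃ i ∈ Finset.univ, 1 / ((k : ℝ) + 1) ≤ c i := by
    refine Finset.exists_le_of_sum_le Finset.univ_nonempty ?_
    rw [hc1, Finset.sum_const, Finset.card_univ, Fintype.card_fin, nsmul_eq_mul]
    push_cast
    rw [mul_one_div_cancel (by positivity)]
  have hne : ∀ j, v i ≠ v (i.succAbove j) := fun j hij =>
    i.succAbove_ne j (hv.injective hij.symm)
  choose w hw ℓ hℓ hwℓ using fun j : Fin k =>
    h.exists_smul _ _ (hne j) (isExposed_segment_vertices hv i j)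
  have hk : ∀ _ : Fin k, (0 : ℝ) < k := fun j => by exact_mod_cast j.pos
  have hℓ0 : ∀ j, 0 < ℓ j := fun j => by
    have := hk j
    exact lt_of_lt_of_le (by positivity) (hℓ j)
  have hli : LinearIndependent ℝ w := by
    have h1 := (linearIndependent_succAbove_sub hv i).units_smul
      fun j => (Units.mk0 (ℓ j) (hℓ0 j).ne')⁻¹
    have h2 : w = (fun j => (Units.mk0 (ℓ j) (hℓ0 j).ne')⁻¹) •
        fun j => v (i.succAbove j) - v i := by
      ext1 j
      simp [hwℓ j, Units.smul_def, smul_smul, (hℓ0 j).ne']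
    rw [h2]
    exact h1
  have hp' : ∑ m, c m • v m = v i + ∑ j, (c (i.succAbove j) * ℓ j) • w j := by
    rw [Fin.sum_univ_succAbove _ i] at hc1 ⊢
    simp only [mul_smul, ← hwℓ, smul_sub, Finset.sum_sub_distrib, ← Finset.sum_smul]
    rw [show c i = 1 - ∑ j, c (i.succAbove j) by linarith]
    module
  -- Coordinates are rounded down, so the box at `a` with sides `w j` contains `p`, which sits there
  -- at the fractional parts.
  set a := v i + ∑ j, ⌊c (i.succAbove j) * ℓ j⌋ • w j with ha
  have haL : a ∈ intLattice n := (intLattice n).add_mem (hP.2 (vertex_mem_extremePoints hv i))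
    ((intLattice n).sum_mem fun j _ => (intLattice n).zsmul_mem (hw j) _)
  refine ⟨a +ᵥ parallelepiped w, ⟨⟨k, a, w, hli, rfl⟩,
    isLatticePolytope_vadd_parallelepiped haL hw, ?_⟩, ?_⟩
  · rintro _ ⟨_, ⟨t, ht, rfl⟩, rfl⟩
    have hcongr : a + ∑ j, t j • w j = v i +
        ∑ j, ((⌊c (i.succAbove j) * ℓ j⌋ + t j) / ℓ j) • (v (i.succAbove j) - v i) := by
      rw [ha, add_assoc, ← Finset.sum_add_distrib]
      congr 1
      refine Finset.sum_congr rfl fun j _ => ?_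
      rw [hwℓ, smul_smul, div_mul_cancel₀ _ (hℓ0 j).ne', add_smul, Int.cast_smul_eq_zsmul]
    change a + ∑ j, t j • w j ∈ _
    rw [hcongr]
    refine add_sum_smul_sub_mem_convexHull i _ (fun j => ?_) ?_
    · have h1 : (0 : ℝ) ≤ ⌊c (i.succAbove j) * ℓ j⌋ := by
        exact_mod_cast Int.floor_nonneg.2 (mul_nonneg (hc0 _) (hℓ0 j).le)
      exact div_nonneg (add_nonneg h1 (ht.1 j)) (hℓ0 j).le
    -- Each of the `k` coordinates exceeds that of `p` by at most `1 / ℓ j ≤ 1 / (k(k+1))`, in total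
    -- at most `1 / (k+1) ≤ c i`.
    · calc ∑ j, (⌊c (i.succAbove j) * ℓ j⌋ + t j) / ℓ j
          ≤ ∑ j, (c (i.succAbove j) + 1 / (k * (k + 1))) := by
            refine Finset.sum_le_sum fun j _ => ?_
            have h1 := Int.floor_le (c (i.succAbove j) * ℓ j)
            have h2 : t j ≤ 1 := ht.2 j
            have h3 : (0 : ℝ) < k * (k + 1) := by
              have := hk j
              positivity
            calc (⌊c (i.succAbove j) * ℓ j⌋ + t j) / ℓ j
                ≤ (c (i.succAbove j) * ℓ j + 1) / ℓ j := by
                  have := (hℓ0 j).le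
                  gcongr
              _ = c (i.succAbove j) + 1 / ℓ j := by
                  rw [add_div, mul_div_cancel_right₀ _ (hℓ0 j).ne']
              _ ≤ _ := by
                  have := hℓ j
                  gcongr
        _ = 1 - c i + k * (1 / (k * (k + 1))) := by
            rw [Fin.sum_univ_succAbove _ i] at hc1
            rw [Finset.sum_add_distrib, Finset.sum_const, Finset.card_univ, Fintype.card_fin,
              nsmul_eq_mul]
            linarith
        _ ≤ 1 := by
            -- For `k = 0` the correction term is `0` and nonnegativity of `c i` suffices.
            rcases Nat.eq_zero_or_pos k with h0 | h0
            · have h1 := hc0 i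
              subst h0
              simpa using h1
            · have h1 : (0 : ℝ) < k := by exact_mod_cast h0
              have h2 : (k : ℝ) * (1 / (k * (k + 1))) = 1 / (k + 1) := by field_simp
              linarith
  · rw [hp']
    refine ⟨∑ j, Int.fract (c (i.succAbove j) * ℓ j) • w j, ⟨fun j =>
      Int.fract (c (i.succAbove j) * ℓ j), ⟨fun j => Int.fract_nonneg _,
        fun j => (Int.fract_lt_one _).le⟩, rfl⟩, ?_⟩
    change a + _ = _
    rw [ha, add_assoc, ← Finset.sum_add_distrib]
    congr 1
    refine Finset.sum_congr rfl fun j _ => ?_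
    rw [← Int.cast_smul_eq_zsmul ℝ, ← add_smul, Int.floor_add_fract]

end Covering

end LatticePolytope

theorem theorem1p3 {n : ℕ} (d : ℕ) (P : Set (EuclideanSpace ℝ (Fin n)))
    (hP : LatticePolytope.IsLatticePolytope P) (hd : LatticePolytope.HasDim P d) :
    (LatticePolytope.EdgesAtLeast P (2 * (d : ℝ) ^ 2 * ((d : ℝ) + 1)) →
      LatticePolytope.IntegrallyClosed P ∧ LatticePolytope.IsNormal P) ∧
    (LatticePolytope.IsSimplex P → LatticePolytope.EdgesAtLeast P ((d : ℝ) * ((d : ℝ) + 1)) →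
      LatticePolytope.CoveredByLatticeParallelepipeds P ∧ LatticePolytope.IntegrallyClosed P) := by
  have hd0 : (0 : ℝ) ≤ d := d.cast_nonneg
  refine ⟨fun h => ?_, fun hs h => ?_⟩
  · have hc := LatticePolytope.integrallyClosed_of_edgesAtLeast hP hd
      (by nlinarith [mul_nonneg (sq_nonneg (d : ℝ)) hd0]) h
    exact ⟨hc, hc.isNormal⟩
  -- Integral closedness comes from `d² ≤ d(d+1)` and the decomposition, not from the covering.
  · exact ⟨LatticePolytope.coveredByLatticeParallelepipeds_of_isSimplex hP hd hs h,
      LatticePolytope.integrallyClosed_of_edgesAtLeast hP hd (by nlinarith) h⟩
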